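/- **Definitions.** A *bounded Lorentzian metric space* (Minguzzi–Suhr) is a nonempty set $X$ with a function $\tau\colon X\times X\to[0,\infty)$ such that (a) $\tau(x,y)+\tau(y,z)\le\tau(x,z)$ whenever $\tau(x,y)>0$ and $\tau(y,z)>0$; (b) there is a topology $T$ on $X$ for which $\tau$ is continuous and $\{\tau\ge\varepsilon\}$ is compact for every $\varepsilon>0$, with respect to the product topology $T\times T$ on $X\times X$; (c) for all $x\ne y$ in $X$ there is $z\in X$ with $\tau(x,z)\ne\tau(y,z)$ or $\tau(z,x)\ne\tau(z,y)$. It carries the coarsest topology as in (b) and the corresponding Borel $\sigma$-algebra. A *spacelike boundary* of $X$ is a point $i^0\in X$ (necessarily unique) with $\tau(i^0,x)=\tau(x,i^0)=0$ for every $x\in X$. A *normalized bounded Lorentzian metric measure space* is a triple $M=(X,\tau,\mathfrak m)$ of a bounded Lorentzian metric space $(X,\tau)$ and a Borel probability measure $\mathfrak m$ on it. Let $q\colon\operatorname{supp}\mathfrak m\to\tilde X$ be the distance quotient of $\operatorname{supp}\mathfrak m$, i.e. the quotient that identifies $x$ and $y$ if $\tau(x,z)=\tau(y,z)$ and $\tau(z,x)=\tau(z,y)$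 for all $z\in\operatorname{supp}\mathfrak m$; then $(\tilde X,\tilde\tau)$ with $\tilde\tau(q(x),q(y)):=\tau(x,y)$ is again a bounded Lorentzian metric space. Write $\operatorname{supp}q_\sharp\mathfrak m\cup\{i^0\}$ for $\operatorname{supp} q_\sharp\mathfrak m$ together with the spacelike boundary $i^0$ of $\tilde X$, where, if $\tilde X$ has none, an abstract point $i^0$ is adjoined and $\tilde\tau$ is extended by zero. Two normalized bounded Lorentzian metric measure spaces $M$ and $M'$ are *isomorphic* if there is a Borel measurable map $\iota\colon\operatorname{supp}q_\sharp\mathfrak m\cup\{i^0\}\to\operatorname{supp}q'_\sharp\mathfrak m'\cup\{i'^0\}$ which is distance-preserving, i.e. $\tilde\tau(x,y)=\tilde\tau'(\iota(x),\iota(y))$ for all $x,y$, and satisfies $\iota_\sharp(q_\sharp\mathfrak m)=q'_\sharp\mathfrak m'$. For $k\in\mathbb N$ let $\mathsf T^k\colon X^k\to\mathbb R^{k\times k}$, $\mathsf T^k(x_1,\dots,x_k)_{ij}:=\tau(x_i,x_j)$. A *polynomial* is a function on the class of normalized bounded Lorentzian metric measure spaces of the form $\Phi(M)=\int_{X^k}\varphi\circ\mathsf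 T^k\,d\mathfrak m^{\otimes k}$ for some $k\in\mathbb N$ and some bounded continuous $\varphi\colon\mathbb R^{k\times k}\to\mathbb R$. **Theorem (Lorentzian Gromov reconstruction theorem).** Let $M$ and $M'$ be normalized bounded Lorentzian metric measure spaces. 1. $M$ and $M'$ are isomorphic if and only if $\Phi(M)=\Phi(M')$ for every polynomial $\Phi$. 2. Let $(X_i)_{i\in\mathbb N}$ be i.i.d. $M$-valued random variables with law $\mathfrak m$, and let $(X'_i)_{i\in\mathbb N}$ be i.i.d. $M'$-valued random variables with law $\mathfrak m'$, defined on a common probability space. Then $M$ and $M'$ are isomorphic if and only if for every $k\in\mathbb N$ the random matrices $\mathsf T^k(X_1,\dots,X_k)$ and $\mathsf T'^k(X'_1,\dots,X'_k)$ coincide in law. -/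

import Mathlib

open MeasureTheory ProbabilityTheory
open scoped NNReal BoundedContinuousFunction

universe u v w

/-- A set `X` with a function `τ : X × X → [0, ∞)`, no axioms imposed (see `IsBoundedLorentzian`). -/
structure TimeSepSpace where
  carrier : Type u
  τ : carrier → carrier → ℝ≥0

namespace TimeSepSpace

instance : CoeSort TimeSepSpace.{u} (Type u) := ⟨TimeSepSpace.carrier⟩

/-- `τ` is continuous for the product topology `T × T`, and all its superlevel sets `{τ ≥ ε}`,
`ε > 0`, are compact in it. -/
def IsAdmissible (X : TimeSepSpace.{u}) (T : TopologicalSpace X) : Prop :=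
  letI := T
  Continuous (fun p : X × X => X.τ p.1 p.2) ∧
    ∀ ε : ℝ≥0, 0 < ε → IsCompact {p : X × X | ε ≤ X.τ p.1 p.2}

/-- Bounded Lorentzian metric spaces in the sense of Minguzzi and Suhr. -/
structure IsBoundedLorentzian (X : TimeSepSpace.{u}) : Prop where
  nonempty : Nonempty X
  reverse_triangle : ∀ x y z : X, 0 < X.τ x y → 0 < X.τ y z → X.τ x y + X.τ y z ≤ X.τ x z
  exists_admissible : ∃ T : TopologicalSpace X, X.IsAdmissible T
  distinguishes : ∀ x y : X, x ≠ y → ∃ z : X, X.τ x z ≠ X.τ y z ∨ X.τ z x ≠ X.τ z y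

/-- The coarsest admissible topology. In Mathlib's order on topologies finer means smaller, so
that the coarsest one is the supremum. -/
instance coarsestTopology (X : TimeSepSpace.{u}) : TopologicalSpace X :=
  sSup {T | X.IsAdmissible T}

instance borelMeasurableSpace (X : TimeSepSpace.{u}) : MeasurableSpace X := borel X

instance (X : TimeSepSpace.{u}) : BorelSpace X := ⟨rfl⟩

/-- The restriction of the time separation function to a subset. -/
def restrict (X : TimeSepSpace.{u}) (S : Set X) : TimeSepSpace.{u} where
  carrier := S
  τ x y := X.τ x.1 y.1

/-- Two points are identified if `τ` does not distinguish them. -/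
def distSetoid (X : TimeSepSpace.{u}) : Setoid X where
  r x y := ∀ z : X, X.τ x z = X.τ y z ∧ X.τ z x = X.τ z y
  iseqv :=
    { refl := fun _ _ => ⟨rfl, rfl⟩
      symm := fun h z => ⟨(h z).1.symm, (h z).2.symm⟩
      trans := fun h h' z => ⟨(h z).1.trans (h' z).1, (h z).2.trans (h' z).2⟩ }

/-- The distance quotient, with `τ̃ (q x) (q y) = τ x y`. -/
def distQuotient (X : TimeSepSpace.{u}) : TimeSepSpace.{u} where
  carrier := Quotient X.distSetoid
  τ := Quotient.lift₂ X.τ fun _ y x' _ h h' => (h y).1.trans (h' x').2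

/-- `i` is the spacelike boundary. -/
def IsSpacelikeBoundary (X : TimeSepSpace.{u}) (i : X) : Prop :=
  ∀ x : X, X.τ i x = 0 ∧ X.τ x i = 0

/-- `X ∪ {i⁰}`: a new point `none`, with `τ` extended by zero, is adjoined exactly if `X` has no
spacelike boundary yet. -/
def adjoinBoundary (X : TimeSepSpace.{u}) : TimeSepSpace.{u} where
  carrier := {o : Option X // o = none → ¬ ∃ i : X, X.IsSpacelikeBoundary i}
  τ a b :=
    match a.1, b.1 with
    | some x, some y => X.τ x y
    | _, _ => 0

/-- The inclusion of `X` into `X ∪ {i⁰}`. -/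
def toAdjoinBoundary (X : TimeSepSpace.{u}) (x : X) : X.adjoinBoundary :=
  ⟨some x, fun h => nomatch h⟩

/-- The matrix `T^k(x₁, …, x_k) = (τ(x_i, x_j))_{ij}`. -/
def sepMatrix (X : TimeSepSpace.{u}) (k : ℕ) (x : Fin k → X) : Matrix (Fin k) (Fin k) ℝ :=
  Matrix.of fun i j => (X.τ (x i) (x j) : ℝ)

end TimeSepSpace

instance matrixMeasurableSpace (k : ℕ) : MeasurableSpace (Matrix (Fin k) (Fin k) ℝ) := borel _

instance (k : ℕ) : BorelSpace (Matrix (Fin k) (Fin k) ℝ) := ⟨rfl⟩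

/-- Normalized bounded Lorentzian metric measure spaces: a bounded Lorentzian metric space with a
Borel probability measure (with respect to the coarsest admissible topology). -/
structure NormalizedBLMMS where
  space : TimeSepSpace.{u}
  isBoundedLorentzian : space.IsBoundedLorentzian
  meas : Measure space
  isProbabilityMeasure : IsProbabilityMeasure meas

namespace NormalizedBLMMS

noncomputable section

/-- The distance quotient of the support of the reference measure. -/
def quot (M : NormalizedBLMMS.{u}) : TimeSepSpace.{u} :=
  (M.space.restrict M.meas.support).distQuotient

/-- The canonical projection `q : supp m → M.quot`. -/
def proj (M : NormalizedBLMMS.{u}) (x : M.meas.support) : M.quot :=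
  Quotient.mk (M.space.restrict M.meas.support).distSetoid x

/-- The quotient measure `q_♯ m`. -/
def quotMeas (M : NormalizedBLMMS.{u}) : Measure M.quot :=
  (M.meas.comap (Subtype.val : M.meas.support → M.space)).map M.proj

/-- The set `supp q_♯ m ∪ {i⁰}`, as a subset of `M.quot ∪ {i⁰}`. -/
def isoDomain (M : NormalizedBLMMS.{u}) : Set M.quot.adjoinBoundary :=
  M.quot.toAdjoinBoundary '' M.quotMeas.support ∪ {i | M.quot.adjoinBoundary.IsSpacelikeBoundary i}

/-- The measure `q_♯ m`, viewed on `supp q_♯ m ∪ {i⁰}`. -/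
def isoMeas (M : NormalizedBLMMS.{u}) : Measure M.isoDomain :=
  (M.quotMeas.map M.quot.toAdjoinBoundary).comap
    (Subtype.val : M.isoDomain → M.quot.adjoinBoundary)

/-- Isomorphy: there is a distance-preserving Borel measurable map
`ι : supp q_♯ m ∪ {i⁰} → supp q'_♯ m' ∪ {i'⁰}` with `ι_♯ (q_♯ m) = q'_♯ m'`. -/
def Isomorphic (M : NormalizedBLMMS.{u}) (M' : NormalizedBLMMS.{v}) : Prop :=
  ∃ ι : M.isoDomain → M'.isoDomain,
    Measurable ι ∧
    (∀ x y : M.isoDomain, M.quot.adjoinBoundary.τ x.1 y.1 =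
      M'.quot.adjoinBoundary.τ (ι x).1 (ι y).1) ∧
    M.isoMeas.map ι = M'.isoMeas

/-- The polynomial of degree `k` with kernel `φ ∈ C_b(ℝ^{k×k})`, evaluated at `M`:
`∫ φ ∘ T^k d m^{⊗k}`. -/
def polynomial (k : ℕ) (φ : Matrix (Fin k) (Fin k) ℝ →ᵇ ℝ) (M : NormalizedBLMMS.{u}) : ℝ :=
  haveI := M.isProbabilityMeasure
  ∫ x : Fin k → M.space, φ (M.space.sepMatrix k x) ∂(Measure.pi fun _ => M.meas)

end

end NormalizedBLMMS

open Set Filter Topology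

/-! Topology: if the initial topology of the functions `τ(z, ·)`, `τ(·, z)` is admissible, it is the
coarsest one, since every admissible topology is finer. `continuous_and_isCompact_of_cover` gives
admissibility for the space itself, for the quotient of supp m, and after adjoining i⁰. With i⁰
present the space is compact and metrizable, and supp q_♯m ∪ {i⁰} is all of it. Passing there
changes no matrix law, because supp m maps τ-preservingly to both sides.

Reconstruction: polynomials determine the matrix laws, and these determine the law of the infinite
array (τ(x_m, x_n)) of an i.i.d. sequence. By the strong law almost every sequence is
equidistributed, so equality of the array laws yields equidistributed sequences x, y with the same
array (`exists_isEquidistributed_sepArray_eq`). Record each point by its separations from the x_n,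
respectively the y_n: this gives continuous maps F and G into one sequence space, with F(x_n) =
G(y_n) and G an embedding. Then ι = G⁻¹ ∘ F preserves τ by density, and it transports the measure
because F_♯μ and G_♯ν are limits of the same empirical measures (`exists_continuous_map_eq`).
Conversely, a τ- and measure-preserving map preserves matrix laws. -/

/-! ### Topologies generated by the sections of τ -/

/-- The pairs `(τ x z, τ z x)`, as a function of `z`. -/
def sepSections {Z : Type*} (τ : Z → Z → ℝ≥0) (x : Z) : Z → ℝ≥0 × ℝ≥0 := fun z => (τ x z, τ z x)

/-- If `τ` on `Q` is covered, off the points that are unrelated to all others, by a continuous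
function on `S` with compact superlevel sets, then it is continuous for every Hausdorff topology
which makes its sections and the covering map continuous. -/
theorem continuous_and_isCompact_of_cover {S Q : Type*} [TopologicalSpace S] [TopologicalSpace Q]
    [T2Space Q] {σ : S → S → ℝ≥0} {τ : Q → Q → ℝ≥0} {f : S → Q} (hf : Continuous f)
    (hτ : ∀ s t, τ (f s) (f t) = σ s t) (hσ : Continuous fun p : S × S => σ p.1 p.2)
    (hK : ∀ ε : ℝ≥0, 0 < ε → IsCompact {p : S × S | ε ≤ σ p.1 p.2})
    (hrange : ∀ y, y ∈ range f ∨ ∀ z, τ y z = 0 ∧ τ z y = 0)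
    (hsec : Continuous (sepSections τ)) :
    Continuous (fun p : Q × Q => τ p.1 p.2) ∧
      ∀ ε : ℝ≥0, 0 < ε → IsCompact {p : Q × Q | ε ≤ τ p.1 p.2} := by
  have himage : ∀ ε : ℝ≥0, 0 < ε →
      {p : Q × Q | ε ≤ τ p.1 p.2} = Prod.map f f '' {p : S × S | ε ≤ σ p.1 p.2} := by
    intro ε hε
    ext ⟨x, y⟩
    simp only [mem_ofPred_eq, mem_image, Prod.exists, Prod.map_apply, Prod.mk.injEq]
    constructor
    · intro h
      obtain ⟨s, rfl⟩ := (hrange x).resolve_right fun h0 => by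
        rw [(h0 y).1] at h; exact absurd h (not_le.2 hε)
      obtain ⟨t, rfl⟩ := (hrange y).resolve_right fun h0 => by
        rw [(h0 _).2] at h; exact absurd h (not_le.2 hε)
      exact ⟨s, t, by rwa [← hτ], rfl, rfl⟩
    · rintro ⟨s, t, h, rfl, rfl⟩
      rwa [hτ]
  have hcompact : ∀ ε : ℝ≥0, 0 < ε → IsCompact {p : Q × Q | ε ≤ τ p.1 p.2} := fun ε hε => by
    rw [himage ε hε]
    exact (hK ε hε).image (hf.prodMap hf)
  have hleft : ∀ y, Continuous fun x => τ x y := fun y =>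
    continuous_fst.comp ((continuous_apply y).comp hsec)
  have hright : ∀ x, Continuous fun y => τ x y := fun x =>
    continuous_snd.comp ((continuous_apply x).comp hsec)
  refine ⟨continuous_iff_continuousAt.2 ?_, hcompact⟩
  rintro ⟨x, y⟩
  -- At a zero of τ only upper semicontinuity is at stake, and compact superlevel sets are closed.
  rcases eq_or_lt_of_le (zero_le (a := τ x y)) with h0 | hpos
  · refine tendsto_order.2 ⟨fun a ha => ?_, fun a ha => ?_⟩
    · simp [← h0] at ha
    · have : {p : Q × Q | a ≤ τ p.1 p.2}ᶜ ∈ 𝓝 (x, y) :=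
        (hcompact a (lt_of_le_of_lt zero_le ha)).isClosed.isOpen_compl.mem_nhds (by simpa using ha)
      filter_upwards [this] with p hp
      simpa using hp
  · obtain ⟨ε, hε, hεlt⟩ := exists_between hpos
    -- If τ(x', y) > ε and τ(x, y') > ε, then x' and y' lift to the compact sets A and B. Pairs from
    -- A × B with σ outside O have a compact, hence closed, image that misses (x, y); its complement
    -- is the neighbourhood needed.
    set A : Set S := Prod.fst '' {p : S × S | ε ≤ σ p.1 p.2}
    set B : Set S := Prod.snd '' {p : S × S | ε ≤ σ p.1 p.2}
    have hA : IsCompact A := (hK ε hε).image continuous_fst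
    have hB : IsCompact B := (hK ε hε).image continuous_snd
    have hU : {x' | ε < τ x' y} ∈ 𝓝 x := (isOpen_lt continuous_const (hleft y)).mem_nhds hεlt
    have hV : {y' | ε < τ x y'} ∈ 𝓝 y := (isOpen_lt continuous_const (hright x)).mem_nhds hεlt
    refine tendsto_def.2 fun W hW => ?_
    obtain ⟨O, hOW, hO, htO⟩ := mem_nhds_iff.1 hW
    have hD : IsClosed (Prod.map f f '' (A ×ˢ B ∩ {p : S × S | σ p.1 p.2 ∈ Oᶜ})) :=
      (((hA.prod hB).inter_right (hO.isClosed_compl.preimage hσ)).image (hf.prodMap hf)).isClosed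
    have hxyD : (x, y) ∉ Prod.map f f '' (A ×ˢ B ∩ {p : S × S | σ p.1 p.2 ∈ Oᶜ}) := by
      rintro ⟨⟨s, t⟩, ⟨-, hst⟩, heq⟩
      obtain ⟨rfl, rfl⟩ := Prod.mk.inj heq
      exact hst (by rw [← hτ]; exact htO)
    filter_upwards [hD.isOpen_compl.mem_nhds hxyD, prod_mem_nhds hU hV]
    rintro ⟨x', y'⟩ hp ⟨hx', hy'⟩
    have hx1 : (x', y) ∈ Prod.map f f '' {p : S × S | ε ≤ σ p.1 p.2} := by
      rw [← himage ε hε]; exact le_of_lt (mem_ofPred_eq ▸ hx')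
    have hy1 : (x, y') ∈ Prod.map f f '' {p : S × S | ε ≤ σ p.1 p.2} := by
      rw [← himage ε hε]; exact le_of_lt (mem_ofPred_eq ▸ hy')
    obtain ⟨⟨s, s'⟩, hs, hs'⟩ := hx1
    obtain ⟨⟨t', t⟩, ht, ht'⟩ := hy1
    obtain ⟨rfl, -⟩ := Prod.mk.inj hs'
    obtain ⟨-, rfl⟩ := Prod.mk.inj ht'
    by_contra hcon
    refine hp ⟨(s, t), ⟨⟨⟨_, hs, rfl⟩, ⟨_, ht, rfl⟩⟩, fun h => hcon (hOW ?_)⟩, rfl⟩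
    simpa [hτ] using h

/-- In the topology of its sections, a space with compact superlevel sets and a spacelike boundary
is compact. -/
theorem compactSpace_of_isInducing_sepSections {Z : Type*} [TopologicalSpace Z] {τ : Z → Z → ℝ≥0}
    (hind : IsInducing (sepSections τ))
    (hK : ∀ ε : ℝ≥0, 0 < ε → IsCompact {p : Z × Z | ε ≤ τ p.1 p.2})
    {i : Z} (hi : ∀ z, τ i z = 0 ∧ τ z i = 0) : CompactSpace Z := by
  refine ⟨isCompact_iff_ultrafilter_le_nhds.2 fun U _ => ?_⟩
  by_cases hU : (U : Filter Z) ≤ 𝓝 i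
  · exact ⟨i, mem_univ _, hU⟩
  rw [hind.nhds_eq_comap, ← tendsto_iff_comap, tendsto_pi_nhds] at hU
  push Not at hU
  obtain ⟨z, hz⟩ := hU
  -- An ultrafilter along which g does not tend to 0 contains a superlevel set of g. For a section
  -- of τ, that set lies in a projection of a compact set.
  have key : ∀ g : Z → ℝ≥0, (¬ Tendsto g U (𝓝 0)) → ∃ ε, 0 < ε ∧ {x | ε ≤ g x} ∈ U := by
    intro g hg
    rw [tendsto_order] at hg
    have : ¬ ∀ a > (0 : ℝ≥0), ∀ᶠ b in (U : Filter Z), g b < a := fun h =>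
      hg ⟨fun a ha => absurd ha (by simp), h⟩
    push Not at this
    obtain ⟨ε, hε, h⟩ := this
    refine ⟨ε, hε, ?_⟩
    exact h
  have fin : ∀ K : Set Z, IsCompact K → K ∈ U → ∃ x ∈ univ, (U : Filter Z) ≤ 𝓝 x := fun K hK hKU =>
    let ⟨x, _, hx⟩ := isCompact_iff_ultrafilter_le_nhds.1 hK U (le_principal_iff.2 hKU)
    ⟨x, mem_univ _, hx⟩
  have hz' : ¬ Tendsto (fun x => τ x z) U (𝓝 0) ∨ ¬ Tendsto (fun x => τ z x) U (𝓝 0) := by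
    by_contra! h
    refine hz ?_
    have := h.1.prodMk_nhds h.2
    simpa [sepSections, (hi z).1, (hi z).2] using this
  rcases hz' with h | h
  · obtain ⟨ε, hε, h⟩ := key _ h
    exact fin _ ((hK ε hε).image continuous_fst) (mem_of_superset h fun x hx => ⟨(x, z), hx, rfl⟩)
  · obtain ⟨ε, hε, h⟩ := key _ h
    exact fin _ ((hK ε hε).image continuous_snd) (mem_of_superset h fun x hx => ⟨(z, x), hx, rfl⟩)

/-- Currying embeds the compact space Z into the metrizable space C(Z, ℝ≥0 × ℝ≥0), so Z is itself
metrizable. -/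
theorem secondCountableTopology_of_injective_sepSections {Z : Type*} [TopologicalSpace Z]
    [CompactSpace Z] {τ : Z → Z → ℝ≥0} (hτ : Continuous fun p : Z × Z => τ p.1 p.2)
    (hinj : Function.Injective (sepSections τ)) : SecondCountableTopology Z := by
  let g : C(Z, C(Z, ℝ≥0 × ℝ≥0)) :=
    ContinuousMap.curry ⟨fun p : Z × Z => (τ p.1 p.2, τ p.2 p.1),
      hτ.prodMk (hτ.comp continuous_swap)⟩
  have hg : Function.Injective g := fun x y h =>
    hinj (funext fun z => congrArg (fun k : C(Z, ℝ≥0 × ℝ≥0) => k z) h)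
  have : TopologicalSpace.MetrizableSpace Z :=
    (g.continuous.isClosedEmbedding hg).isEmbedding.metrizableSpace
  infer_instance

/-! ### The coarsest admissible topology, the quotient and the boundary point -/

namespace TimeSepSpace

variable {X : TimeSepSpace.{u}}

/-- The coarsest topology on `X` for which the functions `τ(z, ·)` and `τ(·, z)` are continuous. -/
abbrev sectionTopology (X : TimeSepSpace.{u}) : TopologicalSpace X :=
  TopologicalSpace.induced (sepSections X.τ) inferInstance

theorem IsAdmissible.le_sectionTopology {T : TopologicalSpace X} (h : X.IsAdmissible T) :
    T ≤ X.sectionTopology := by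
  let _ := T
  refine continuous_iff_le_induced.1 (continuous_pi fun z => ?_)
  exact (h.1.comp (continuous_id.prodMk continuous_const)).prodMk
    (h.1.comp (continuous_const.prodMk continuous_id))

theorem coarsestTopology_eq (h : X.IsAdmissible X.sectionTopology) :
    X.coarsestTopology = X.sectionTopology :=
  le_antisymm (sSup_le fun _ hT => IsAdmissible.le_sectionTopology hT) (le_sSup h)

/-- The points of `X` are distinguished by `τ`, and the coarsest admissible topology of `X` is
admissible and induced by the sections of `τ`. -/
structure IsRegular (X : TimeSepSpace.{u}) : Prop where
  injective : Function.Injective (sepSections X.τ)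
  isInducing : IsInducing (sepSections X.τ)
  continuous : Continuous fun p : X × X => X.τ p.1 p.2
  isCompact : ∀ ε : ℝ≥0, 0 < ε → IsCompact {p : X × X | ε ≤ X.τ p.1 p.2}

theorem isRegular_of_cover {S : Type*} [TopologicalSpace S] {σ : S → S → ℝ≥0} {f : S → X}
    (hinj : Function.Injective (sepSections X.τ))
    (hτ : ∀ s t, X.τ (f s) (f t) = σ s t) (hσ : Continuous fun p : S × S => σ p.1 p.2)
    (hK : ∀ ε : ℝ≥0, 0 < ε → IsCompact {p : S × S | ε ≤ σ p.1 p.2})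
    (hrange : ∀ y, y ∈ range f ∨ ∀ z, X.τ y z = 0 ∧ X.τ z y = 0) :
    X.IsRegular ∧ Continuous f := by
  have hf : Continuous[_, X.sectionTopology] f := by
    refine continuous_induced_rng.2 (continuous_pi fun z => ?_)
    rcases hrange z with ⟨t, rfl⟩ | h
    · simp only [Function.comp_apply, sepSections, hτ]
      exact (hσ.comp (continuous_id.prodMk continuous_const)).prodMk
        (hσ.comp (continuous_const.prodMk continuous_id))
    · simp only [Function.comp_apply, sepSections, h]
      exact continuous_const
  have hadm : X.IsAdmissible X.sectionTopology := by
    let _ := X.sectionTopology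
    have hind : IsInducing (sepSections X.τ) := ⟨rfl⟩
    have : T2Space X := .of_injective_continuous hinj hind.continuous
    exact continuous_and_isCompact_of_cover hf hτ hσ hK hrange hind.continuous
  have heq := coarsestTopology_eq hadm
  refine ⟨⟨hinj, ⟨heq⟩, ?_, ?_⟩, ?_⟩
  · rw [heq]; exact hadm.1
  · rw [heq]; exact hadm.2
  · rw [heq]; exact hf

theorem IsRegular.t2Space (h : X.IsRegular) : T2Space X :=
  .of_injective_continuous h.injective h.isInducing.continuous

theorem IsRegular.compactSpace (h : X.IsRegular) {i : X} (hi : X.IsSpacelikeBoundary i) :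
    CompactSpace X :=
  compactSpace_of_isInducing_sepSections h.isInducing h.isCompact hi

theorem IsBoundedLorentzian.injective_sepSections (h : X.IsBoundedLorentzian) :
    Function.Injective (sepSections X.τ) := by
  intro x y hxy
  by_contra hne
  obtain ⟨z, hz⟩ := h.distinguishes x y hne
  have := Prod.mk.inj (congrFun hxy z)
  exact hz.elim (absurd this.1) (absurd this.2)

theorem IsBoundedLorentzian.isRegular (h : X.IsBoundedLorentzian) : X.IsRegular := by
  obtain ⟨T, hT⟩ := h.exists_admissible
  exact (isRegular_of_cover (S := X) (f := id) h.injective_sepSections (fun _ _ => rfl)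
    hT.1 hT.2 fun y => .inl ⟨y, rfl⟩).1

theorem injective_sepSections_distQuotient :
    Function.Injective (sepSections X.distQuotient.τ) := by
  intro x y
  induction x using Quotient.inductionOn with | _ x
  induction y using Quotient.inductionOn with | _ y
  intro h
  refine Quotient.sound fun z => ?_
  exact Prod.mk.inj (congrFun h (Quotient.mk _ z))

theorem injective_sepSections_adjoinBoundary (h : Function.Injective (sepSections X.τ)) :
    Function.Injective (sepSections X.adjoinBoundary.τ) := by
  -- A point of X with the sections of the adjoined point would already be a spacelike boundary of
  -- X.
  have key : ∀ (x : X) (hn : ¬ ∃ i : X, X.IsSpacelikeBoundary i),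
      sepSections X.adjoinBoundary.τ ⟨some x, fun h => nomatch h⟩ ≠
        sepSections X.adjoinBoundary.τ ⟨none, fun _ => hn⟩ := by
    intro x hn heq
    refine hn ⟨x, fun z => ?_⟩
    exact Prod.mk.inj (congrFun heq (X.toAdjoinBoundary z))
  rintro ⟨_ | x, hx⟩ ⟨_ | y, hy⟩ heq
  · rfl
  · exact (key y (hx rfl) heq.symm).elim
  · exact (key x (hy rfl) heq).elim
  · have : x = y := h (funext fun z => congrFun heq (X.toAdjoinBoundary z))
    subst this
    rfl

theorem adjoinBoundary_cases (y : X.adjoinBoundary) :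
    y ∈ range X.toAdjoinBoundary ∨ X.adjoinBoundary.IsSpacelikeBoundary y := by
  obtain ⟨_ | x, hx⟩ := y
  · exact .inr fun z => ⟨rfl, by obtain ⟨_ | z, hz⟩ := z <;> rfl⟩
  · exact .inl ⟨x, rfl⟩

theorem exists_isSpacelikeBoundary_adjoinBoundary (X : TimeSepSpace.{u}) :
    ∃ i, X.adjoinBoundary.IsSpacelikeBoundary i := by
  by_cases h : ∃ i : X, X.IsSpacelikeBoundary i
  · obtain ⟨i, hi⟩ := h
    refine ⟨X.toAdjoinBoundary i, ?_⟩
    rintro ⟨_ | x, hx⟩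
    · exact ⟨rfl, rfl⟩
    · exact hi x
  · refine ⟨⟨none, fun _ => h⟩, fun x => ⟨rfl, by obtain ⟨_ | x, hx⟩ := x <;> rfl⟩⟩

theorem IsRegular.compactSpace_adjoinBoundary (h : X.adjoinBoundary.IsRegular) :
    CompactSpace X.adjoinBoundary :=
  let ⟨_, hi⟩ := X.exists_isSpacelikeBoundary_adjoinBoundary
  h.compactSpace hi

theorem IsRegular.secondCountableTopology_adjoinBoundary (h : X.adjoinBoundary.IsRegular) :
    SecondCountableTopology X.adjoinBoundary :=
  have := h.compactSpace_adjoinBoundary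
  secondCountableTopology_of_injective_sepSections h.continuous h.injective

theorem IsRegular.adjoinBoundary (h : X.IsRegular) :
    X.adjoinBoundary.IsRegular ∧ Continuous X.toAdjoinBoundary :=
  isRegular_of_cover (injective_sepSections_adjoinBoundary h.injective) (fun _ _ => rfl)
    h.continuous h.isCompact adjoinBoundary_cases

/-- X need not be compact, but it inherits second countability from X ∪ {i⁰}: its sections are
restrictions of sections there, so the inclusion is inducing. -/
theorem IsRegular.secondCountableTopology (h : X.IsRegular) : SecondCountableTopology X := by
  have hr := h.adjoinBoundary
  have := hr.1.secondCountableTopology_adjoinBoundary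
  refine IsInducing.secondCountableTopology (f := X.toAdjoinBoundary) ?_
  have hcomp : Continuous fun (g : X.adjoinBoundary → ℝ≥0 × ℝ≥0) (z : X) => g (X.toAdjoinBoundary z) :=
    continuous_pi fun z => continuous_apply _
  exact .of_comp hr.2 (hcomp.comp hr.1.isInducing.continuous) h.isInducing

end TimeSepSpace

/-! ### Laws of the separation matrices and of the infinite array -/

theorem measurable_matrix_of_apply {Ω : Type*} [MeasurableSpace Ω] {k : ℕ}
    {f : Ω → Matrix (Fin k) (Fin k) ℝ} (hf : ∀ i j, Measurable fun ω => f ω i j) :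
    Measurable f := by
  have h : matrixMeasurableSpace k =
      (inferInstance : MeasurableSpace (Fin k → Fin k → ℝ)) :=
    (BorelSpace.measurable_eq (α := Fin k → Fin k → ℝ)).symm
  rw [h]
  exact measurable_pi_lambda _ fun i => measurable_pi_lambda _ fun j => hf i j

theorem measurable_matrix_apply {k : ℕ} (i j : Fin k) :
    Measurable fun A : Matrix (Fin k) (Fin k) ℝ => A i j :=
  (continuous_id.matrix_elem i j).measurable

theorem matrix_measure_ext {k : ℕ} {μ ν : Measure (Matrix (Fin k) (Fin k) ℝ)} [IsFiniteMeasure μ]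
    [IsFiniteMeasure ν]
    (h : ∀ φ : Matrix (Fin k) (Fin k) ℝ →ᵇ ℝ, ∫ A, φ A ∂μ = ∫ A, φ A ∂ν) : μ = ν := by
  have : HasOuterApproxClosed (Matrix (Fin k) (Fin k) ℝ) :=
    inferInstanceAs (HasOuterApproxClosed (Fin k → Fin k → ℝ))
  exact ext_of_forall_integral_eq_of_IsFiniteMeasure h

namespace TimeSepSpace

variable {X : TimeSepSpace.{u}} {Y : TimeSepSpace.{v}}

theorem IsRegular.continuous_τ (h : X.IsRegular) {S : Type*} [TopologicalSpace S] {f g : S → X}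
    (hf : Continuous f) (hg : Continuous g) : Continuous fun s => X.τ (f s) (g s) :=
  Continuous.comp (g := fun p : X × X => X.τ p.1 p.2) h.continuous (hf.prodMk hg)

/-- Second countability makes the Borel σ-algebra of X × X the product one, so continuity of τ gives
joint measurability. -/
theorem IsRegular.measurable_τ (h : X.IsRegular) {Ω : Type*} [MeasurableSpace Ω] {f g : Ω → X}
    (hf : Measurable f) (hg : Measurable g) : Measurable fun ω => (X.τ (f ω) (g ω) : ℝ) := by
  have := h.secondCountableTopology
  exact (NNReal.continuous_coe.comp h.continuous).measurable.comp (hf.prodMk hg)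

theorem IsRegular.measurable_sepMatrix (h : X.IsRegular) (k : ℕ) : Measurable (X.sepMatrix k) :=
  measurable_matrix_of_apply fun i j =>
    h.measurable_τ (measurable_pi_apply i) (measurable_pi_apply j)

/-- The infinite matrix of the time separations in a sequence of points. -/
def sepArray (X : TimeSepSpace.{u}) (x : ℕ → X) : ℕ × ℕ → ℝ := fun p => X.τ (x p.1) (x p.2)

theorem IsRegular.measurable_sepArray (h : X.IsRegular) : Measurable X.sepArray :=
  measurable_pi_lambda _ fun p => h.measurable_τ (measurable_pi_apply p.1) (measurable_pi_apply p.2)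

theorem IsRegular.continuous_sepArray (h : X.IsRegular) : Continuous X.sepArray :=
  continuous_pi fun p => NNReal.continuous_coe.comp
    (h.continuous_τ (continuous_apply p.1) (continuous_apply p.2))

theorem IsRegular.continuous_sepColumn (h : X.IsRegular) (x : ℕ → X) :
    Continuous fun (y : X) (n : ℕ) => sepSections X.τ y (x n) :=
  continuous_pi fun n => (continuous_apply (x n)).comp h.isInducing.continuous

theorem IsRegular.map_sepMatrix_of_iIndepFun (h : X.IsRegular) {Ω : Type*} [MeasurableSpace Ω]
    {P : Measure Ω} [IsProbabilityMeasure P] {μ : Measure X} {x : ℕ → Ω → X}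
    (hx : ∀ i, Measurable (x i)) (hind : iIndepFun x P) (hlaw : ∀ i, P.map (x i) = μ) (k : ℕ) :
    P.map (fun ω => X.sepMatrix k fun i => x i ω) =
      (Measure.pi fun _ : Fin k => μ).map (X.sepMatrix k) := by
  have hpi := (iIndepFun_iff_map_fun_eq_pi_map fun i : Fin k => (hx i).aemeasurable).1
    (hind.precomp Fin.val_injective)
  simp only [hlaw] at hpi
  rw [← hpi, Measure.map_map (h.measurable_sepMatrix k) (measurable_pi_lambda _ fun i => hx i)]
  rfl

theorem map_pi_sepMatrix_eq {L : Type*} [MeasurableSpace L] {ρ : Measure L}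
    [IsProbabilityMeasure ρ] (hX : X.IsRegular) (hY : Y.IsRegular) {f : L → X} {g : L → Y}
    (hf : Measurable f) (hg : Measurable g) (h : ∀ s t, X.τ (f s) (f t) = Y.τ (g s) (g t)) (k : ℕ) :
    (Measure.pi fun _ : Fin k => ρ.map f).map (X.sepMatrix k) =
      (Measure.pi fun _ : Fin k => ρ.map g).map (Y.sepMatrix k) := by
  have := Measure.isProbabilityMeasure_map (μ := ρ) hf.aemeasurable
  have := Measure.isProbabilityMeasure_map (μ := ρ) hg.aemeasurable
  rw [← Measure.pi_map_pi fun _ => hf.aemeasurable, ← Measure.pi_map_pi fun _ => hg.aemeasurable,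
    Measure.map_map (hX.measurable_sepMatrix k) (by fun_prop),
    Measure.map_map (hY.measurable_sepMatrix k) (by fun_prop)]
  congr 1
  ext x i j
  simp [sepMatrix, h]

theorem IsRegular.map_restrict_map_sepArray (h : X.IsRegular) {μ : Measure X}
    [IsProbabilityMeasure μ] {I : Finset (ℕ × ℕ)} {k : ℕ} (hk : ∀ p ∈ I, p.1 < k ∧ p.2 < k) :
    ((Measure.infinitePi fun _ : ℕ => μ).map X.sepArray).map I.restrict =
      ((Measure.pi fun _ : Fin k => μ).map (X.sepMatrix k)).map
        fun A (p : I) => A ⟨p.1.1, (hk p.1 p.2).1⟩ ⟨p.1.2, (hk p.1 p.2).2⟩ := by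
  have hind : iIndepFun (fun (i : ℕ) (ω : ℕ → X) => ω i) (Measure.infinitePi fun _ => μ) :=
    iIndepFun_infinitePi (X := fun _ z => z) fun _ => measurable_id
  have hm : Measurable fun ω : ℕ → X => X.sepMatrix k fun i => ω i :=
    (h.measurable_sepMatrix k).comp (by fun_prop)
  rw [← h.map_sepMatrix_of_iIndepFun (fun i => measurable_pi_apply i) hind
    (fun i => Measure.infinitePi_map_eval _ i) k, Measure.map_map (by fun_prop) h.measurable_sepArray,
    Measure.map_map (measurable_pi_lambda _ fun p => measurable_matrix_apply _ _) hm]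
  rfl

/-- Finitely many entries of the array lie in a k × k corner, and finite-dimensional marginals
determine the law. -/
theorem map_sepArray_eq {μ : Measure X} {ν : Measure Y} [IsProbabilityMeasure μ]
    [IsProbabilityMeasure ν] (hX : X.IsRegular) (hY : Y.IsRegular)
    (h : ∀ k, (Measure.pi fun _ : Fin k => μ).map (X.sepMatrix k) =
      (Measure.pi fun _ : Fin k => ν).map (Y.sepMatrix k)) :
    (Measure.infinitePi fun _ : ℕ => μ).map X.sepArray =
      (Measure.infinitePi fun _ : ℕ => ν).map Y.sepArray := by
  have := Measure.isProbabilityMeasure_map (μ := Measure.infinitePi fun _ : ℕ => ν)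
    hY.measurable_sepArray.aemeasurable
  refine IsProjectiveLimit.unique
    (P := fun I => ((Measure.infinitePi fun _ : ℕ => ν).map Y.sepArray).map I.restrict)
    (fun I => ?_) (fun I => rfl)
  obtain ⟨k, hk⟩ : ∃ k, ∀ p ∈ I, p.1 < k ∧ p.2 < k := by
    refine ⟨I.sup (fun p => max p.1 p.2) + 1, fun p hp => ?_⟩
    have : max p.1 p.2 ≤ _ := Finset.le_sup (f := fun p : ℕ × ℕ => max p.1 p.2) hp
    omega
  change _ = ((Measure.infinitePi fun _ : ℕ => ν).map Y.sepArray).map I.restrict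
  rw [hX.map_restrict_map_sepArray hk, hY.map_restrict_map_sepArray hk, h]

end TimeSepSpace

/-! ### Equidistributed sequences -/

/-- The empirical measures of the sequence `z` converge weakly to `μ`. -/
def IsEquidistributed {Z : Type*} [TopologicalSpace Z] [MeasurableSpace Z] (μ : Measure Z)
    (z : ℕ → Z) : Prop :=
  ∀ f : C(Z, ℝ), Tendsto (fun n : ℕ => (∑ i ∈ Finset.range n, f (z i)) / n) atTop (𝓝 (∫ y, f y ∂μ))

section Equidistribution

variable {Z : Type*} [TopologicalSpace Z] [CompactSpace Z] [MeasurableSpace Z] [BorelSpace Z]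
  {μ : Measure Z} [IsProbabilityMeasure μ]

theorem integrable_of_continuousMap (f : C(Z, ℝ)) : Integrable f μ :=
  .of_bound f.continuous.aestronglyMeasurable ‖f‖ (.of_forall f.norm_coe_le_norm)

theorem isEquidistributed_of_dense {z : ℕ → Z} {D : Set C(Z, ℝ)} (hD : Dense D)
    (h : ∀ f ∈ D, Tendsto (fun n : ℕ => (∑ i ∈ Finset.range n, f (z i)) / n) atTop
      (𝓝 (∫ y, f y ∂μ))) : IsEquidistributed μ z := by
  intro f
  rw [Metric.tendsto_atTop]
  intro ε hε
  obtain ⟨g, hgD, hg⟩ := hD.exists_dist_lt f (show 0 < ε / 3 by positivity)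
  obtain ⟨N, hN⟩ := Metric.tendsto_atTop.1 (h g hgD) (ε / 3) (by positivity)
  refine ⟨N, fun n hn => ?_⟩
  have hfg : ∀ y, |f y - g y| ≤ ε / 3 := fun y =>
    (ContinuousMap.dist_apply_le_dist (f := f) (g := g) y).trans hg.le
  have h1 : |(∑ i ∈ Finset.range n, f (z i)) / n - (∑ i ∈ Finset.range n, g (z i)) / n| ≤ ε / 3 := by
    rw [← sub_div, ← Finset.sum_sub_distrib, abs_div, Nat.abs_cast]
    rcases n.eq_zero_or_pos with rfl | hpos
    · simp; positivity
    rw [div_le_iff₀ (by exact_mod_cast hpos)]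
    calc |∑ i ∈ Finset.range n, (f (z i) - g (z i))|
        ≤ ∑ i ∈ Finset.range n, |f (z i) - g (z i)| := Finset.abs_sum_le_sum_abs _ _
      _ ≤ ∑ i ∈ Finset.range n, ε / 3 := Finset.sum_le_sum fun i _ => hfg _
      _ = ε / 3 * n := by simp [mul_comm]
  have h2 : |∫ y, f y ∂μ - ∫ y, g y ∂μ| ≤ ε / 3 := by
    rw [← integral_sub (integrable_of_continuousMap f) (integrable_of_continuousMap g)]
    simpa using norm_integral_le_of_norm_le_const (μ := μ) (f := fun y => f y - g y) (.of_forall hfg)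
  have h3 := hN n hn
  rw [Real.dist_eq] at h3 ⊢
  rw [abs_le] at h1 h2
  rw [abs_lt] at h3 ⊢
  constructor <;> linarith [h1.1, h1.2, h2.1, h2.2, h3.1, h3.2]

/-- C(Z, ℝ) is separable, so the strong law is needed only for countably many functions; uniform
approximation handles the rest. -/
theorem ae_isEquidistributed [T2Space Z] [SecondCountableTopology Z] (μ : Measure Z) [IsProbabilityMeasure μ] :
    ∀ᵐ z ∂Measure.infinitePi fun _ : ℕ => μ, IsEquidistributed μ z := by
  obtain ⟨D, hDc, hD⟩ := TopologicalSpace.exists_countable_dense C(Z, ℝ)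
  have : ∀ᵐ z ∂Measure.infinitePi fun _ : ℕ => μ, ∀ f ∈ D,
      Tendsto (fun n : ℕ => (∑ i ∈ Finset.range n, f (z i)) / n) atTop (𝓝 (∫ y, f y ∂μ)) := by
    refine (ae_ball_iff hDc).2 fun f _ => ?_
    have hmp : ∀ i : ℕ, MeasurePreserving (fun z : ℕ → Z => z i) (Measure.infinitePi fun _ => μ) μ :=
      measurePreserving_eval_infinitePi _
    have hlaw := strong_law_ae_real (μ := Measure.infinitePi fun _ : ℕ => μ)
      (fun i (z : ℕ → Z) => f (z i))
      ((hmp 0).integrable_comp_of_integrable (integrable_of_continuousMap f))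
      (fun i j hij => (iIndepFun_infinitePi (X := fun _ => f)
        fun _ => f.continuous.measurable).indepFun hij)
      (fun i => IdentDistrib.comp ⟨(hmp i).aemeasurable, (hmp 0).aemeasurable,
        (hmp i).map_eq.trans (hmp 0).map_eq.symm⟩ f.continuous.measurable)
    have hint : ∫ z : ℕ → Z, f (z 0) ∂(Measure.infinitePi fun _ => μ) = ∫ y, f y ∂μ := by
      rw [← integral_map (hmp 0).aemeasurable f.continuous.aestronglyMeasurable, (hmp 0).map_eq]
    rwa [hint] at hlaw
  filter_upwards [this] with z hz using isEquidistributed_of_dense hD hz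

/-- A Urysohn function vanishing on the sequence but not at a support point would have zero averages
and positive integral. -/
theorem IsEquidistributed.support_subset [T2Space Z] {z : ℕ → Z} (hz : IsEquidistributed μ z) :
    μ.support ⊆ closure (range z) := by
  intro y hy
  by_contra hcl
  obtain ⟨f, hf0, hf1, hf⟩ := exists_continuous_zero_one_of_isClosed isClosed_closure
    (isClosed_singleton (x := y)) (disjoint_singleton_right.2 hcl)
  have h0 : ∫ y, f y ∂μ = 0 := by
    refine tendsto_nhds_unique (hz f) (tendsto_const_nhds.congr fun n => ?_)
    rw [Finset.sum_eq_zero fun i _ => hf0 (subset_closure (mem_range_self i)), zero_div]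
  rw [integral_eq_zero_iff_of_nonneg (fun y => (hf y).1) (integrable_of_continuousMap f)] at h0
  have hU : {x | f x ≠ 0} ∈ 𝓝 y :=
    (isOpen_ne_fun f.continuous continuous_const).mem_nhds (by simp [hf1 rfl])
  exact ((Measure.mem_support_iff_forall y).1 hy _ hU).ne' h0

end Equidistribution

/-! ### Reconstruction from two equidistributed sequences with the same array -/

namespace TimeSepSpace

variable {X : TimeSepSpace.{u}} {Y : TimeSepSpace.{v}} [CompactSpace X] [CompactSpace Y]
  {μ : Measure X} {ν : Measure Y} [IsProbabilityMeasure μ] [IsProbabilityMeasure ν]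

/-- Compactness makes the image under `sepArray` measurable; mass above one half forces two such
images to meet under a common law. -/
theorem IsRegular.exists_isCompact_isEquidistributed (h : X.IsRegular) :
    ∃ K : Set (ℕ → X), IsCompact K ∧ (∀ z ∈ K, IsEquidistributed μ z) ∧
      2⁻¹ < (Measure.infinitePi fun _ : ℕ => μ) K := by
  have := h.t2Space
  have := h.secondCountableTopology
  obtain ⟨t, htsub, ht, htz⟩ := exists_measurable_superset_of_null
    (mem_ae_iff.1 (ae_isEquidistributed μ))
  have h1 : (Measure.infinitePi fun _ : ℕ => μ) tᶜ = 1 := (prob_compl_eq_one_iff ht).2 htz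
  obtain ⟨K, hKt, hK, hlt⟩ := ht.compl.exists_lt_isCompact
    (μ := Measure.infinitePi fun _ : ℕ => μ) (r := 2⁻¹) (by rw [h1]; simp)
  exact ⟨K, hK, fun z hz => by_contra fun hcon => hKt hz (htsub hcon), hlt⟩

theorem exists_isEquidistributed_sepArray_eq (hX : X.IsRegular) (hY : Y.IsRegular)
    (h : (Measure.infinitePi fun _ : ℕ => μ).map X.sepArray =
      (Measure.infinitePi fun _ : ℕ => ν).map Y.sepArray) :
    ∃ (x : ℕ → X) (y : ℕ → Y), IsEquidistributed μ x ∧ IsEquidistributed ν y ∧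
      X.sepArray x = Y.sepArray y := by
  obtain ⟨K, hK, hKe, hKlt⟩ := hX.exists_isCompact_isEquidistributed (μ := μ)
  obtain ⟨L, hL, hLe, hLlt⟩ := hY.exists_isCompact_isEquidistributed (μ := ν)
  have hcK := hK.image hX.continuous_sepArray
  have hcL := hL.image hY.continuous_sepArray
  have := Measure.isProbabilityMeasure_map (μ := Measure.infinitePi fun _ : ℕ => ν)
    hY.measurable_sepArray.aemeasurable
  have h1 : 2⁻¹ < ((Measure.infinitePi fun _ : ℕ => ν).map Y.sepArray) (X.sepArray '' K) := by
    rw [← h, Measure.map_apply hX.measurable_sepArray hcK.measurableSet]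
    exact hKlt.trans_le (measure_mono (subset_preimage_image _ _))
  have h2 : 2⁻¹ < ((Measure.infinitePi fun _ : ℕ => ν).map Y.sepArray) (Y.sepArray '' L) := by
    rw [Measure.map_apply hY.measurable_sepArray hcL.measurableSet]
    exact hLlt.trans_le (measure_mono (subset_preimage_image _ _))
  obtain ⟨_, ⟨x, hx, rfl⟩, ⟨y, hy, hxy⟩⟩ : (X.sepArray '' K ∩ Y.sepArray '' L).Nonempty := by
    refine nonempty_inter_of_measure_lt_add
      ((Measure.infinitePi fun _ : ℕ => ν).map Y.sepArray) hcL.measurableSet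
      (subset_univ _) (subset_univ _) ?_
    rw [measure_univ, ← ENNReal.inv_two_add_inv_two]
    exact ENNReal.add_lt_add h1 h2
  exact ⟨x, y, hKe x hx, hLe y hy, hxy.symm⟩

theorem exists_continuous_map_eq (hX : X.IsRegular) (hY : Y.IsRegular) {i : X} {j : Y}
    (hi : X.IsSpacelikeBoundary i) (hj : Y.IsSpacelikeBoundary j)
    (hμ : ∀ x, x ∈ μ.support ∨ X.IsSpacelikeBoundary x)
    (hν : ∀ y, y ∈ ν.support ∨ Y.IsSpacelikeBoundary y)
    (h : ∀ k, (Measure.pi fun _ : Fin k => μ).map (X.sepMatrix k) =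
      (Measure.pi fun _ : Fin k => ν).map (Y.sepMatrix k)) :
    ∃ ι : X → Y, Continuous ι ∧ (∀ x y, X.τ x y = Y.τ (ι x) (ι y)) ∧ μ.map ι = ν := by
  have := hX.t2Space
  have := hY.t2Space
  have := hX.secondCountableTopology
  have := hY.secondCountableTopology
  obtain ⟨x, y, hx, hy, hxy⟩ := exists_isEquidistributed_sepArray_eq hX hY (map_sepArray_eq hX hY h)
  have hxy' : ∀ m n, X.τ (x m) (x n) = Y.τ (y m) (y n) := fun m n =>
    NNReal.coe_injective (congrFun hxy (m, n))
  set F : X → ℕ → ℝ≥0 × ℝ≥0 := fun p n => sepSections X.τ p (x n) with hFdef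
  set G : Y → ℕ → ℝ≥0 × ℝ≥0 := fun p n => sepSections Y.τ p (y n) with hGdef
  have hF : Continuous F := hX.continuous_sepColumn x
  have hG : Continuous G := hY.continuous_sepColumn y
  have hFG : ∀ n, F (x n) = G (y n) := fun n => by
    ext m : 1
    simp [hFdef, hGdef, sepSections, hxy']
  have hFGb : F i = G j := by
    ext m : 1
    simp [hFdef, hGdef, sepSections, hi _, hj _]
  have hbi : ∀ p, X.IsSpacelikeBoundary p → p = i := fun p hp =>
    hX.injective (funext fun z => by simp [sepSections, hi _, hp _])
  -- Equal columns mean sections that agree on the y_n, hence on their closure, which contains supp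
  -- ν. Any other point is the boundary, where all sections vanish.
  have hGinj : Function.Injective G := by
    intro p q hpq
    refine hY.injective (funext fun z => ?_)
    rcases hν z with hz | hz
    · refine closure_minimal (t := {z | sepSections Y.τ p z = sepSections Y.τ q z}) ?_
        (isClosed_eq ?_ ?_) (hy.support_subset hz)
      · rintro _ ⟨n, rfl⟩
        exact congrFun hpq n
      all_goals
        exact (hY.continuous_τ continuous_const continuous_id).prodMk
          (hY.continuous_τ continuous_id continuous_const)
    · simp [sepSections, hz _]
  have hGe := hG.isClosedEmbedding hGinj
  have hrange : ∀ p, ∃ q, G q = F p := by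
    intro p
    rcases hμ p with hp | hp
    · refine closure_minimal (t := F ⁻¹' range G) ?_ (hGe.isClosed_range.preimage hF)
        (hx.support_subset hp)
      rintro _ ⟨n, rfl⟩
      exact ⟨y n, (hFG n).symm⟩
    · exact ⟨j, by rw [hbi p hp, hFGb]⟩
  choose ι hι using hrange
  have hιF : G ∘ ι = F := funext hι
  have hιc : Continuous ι := hGe.isInducing.continuous_iff.2 (hιF ▸ hF)
  have hιx : ∀ n, ι (x n) = y n := fun n => hGinj ((hι _).trans (hFG n))
  have hιi : ι i = j := hGinj ((hι _).trans hFGb)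
  refine ⟨ι, hιc, fun p q => ?_, ?_⟩
  · rcases hμ p with hp | hp
    · refine closure_minimal (t := {p | X.τ p q = Y.τ (ι p) (ι q)}) ?_ (isClosed_eq ?_ ?_)
        (hx.support_subset hp)
      · rintro _ ⟨n, rfl⟩
        have := congrArg Prod.snd (congrFun (hι q) n)
        change X.τ (x n) q = Y.τ (ι (x n)) (ι q)
        rw [hιx]
        exact this.symm
      · exact hX.continuous_τ continuous_id continuous_const
      · exact hY.continuous_τ hιc continuous_const
    · rw [hbi p hp, hιi, (hi q).1, (hj _).1]
  · have hmap : μ.map F = ν.map G := by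
      have := Measure.isProbabilityMeasure_map (μ := μ) hF.measurable.aemeasurable
      have := Measure.isProbabilityMeasure_map (μ := ν) hG.measurable.aemeasurable
      refine ext_of_forall_integral_eq_of_IsFiniteMeasure fun g => ?_
      rw [integral_map hF.measurable.aemeasurable g.continuous.aestronglyMeasurable,
        integral_map hG.measurable.aemeasurable g.continuous.aestronglyMeasurable]
      refine tendsto_nhds_unique (hx ⟨fun p => g (F p), g.continuous.comp hF⟩) ?_
      simpa [hFG] using hy ⟨fun p => g (G p), g.continuous.comp hG⟩
    rw [← hιF, ← Measure.map_map hG.measurable hιc.measurable] at hmap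
    exact hGe.measurableEmbedding.map_injective hmap

end TimeSepSpace

/-! ### Passage from M to its compact model -/

namespace NormalizedBLMMS

variable {M : NormalizedBLMMS.{u}} {M' : NormalizedBLMMS.{v}}

theorem isRegular_space (M : NormalizedBLMMS.{u}) : M.space.IsRegular :=
  M.isBoundedLorentzian.isRegular

theorem isRegular_quot_and_continuous_proj (M : NormalizedBLMMS.{u}) :
    M.quot.IsRegular ∧ Continuous M.proj := by
  have h := M.isRegular_space
  have hval : IsClosedEmbedding (Subtype.val : M.meas.support → M.space) :=
    Measure.isClosed_support.isClosedEmbedding_subtypeVal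
  refine TimeSepSpace.isRegular_of_cover (σ := fun s t => M.space.τ s.1 t.1)
    TimeSepSpace.injective_sepSections_distQuotient (fun _ _ => rfl)
    (h.continuous_τ (continuous_subtype_val.comp continuous_fst)
      (continuous_subtype_val.comp continuous_snd))
    (fun ε hε => by
      exact (hval.prodMap hval).isCompact_preimage (h.isCompact ε hε))
    (fun y => .inl ?_)
  obtain ⟨x, rfl⟩ := Quotient.exists_rep y
  exact ⟨x, rfl⟩

theorem isRegular_adjoinBoundary_quot (M : NormalizedBLMMS.{u}) :
    M.quot.adjoinBoundary.IsRegular :=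
  M.isRegular_quot_and_continuous_proj.1.adjoinBoundary.1

/-- The map from `supp m` to `M.quot ∪ {i⁰}`. -/
def toCompletion (M : NormalizedBLMMS.{u}) (x : M.meas.support) : M.quot.adjoinBoundary :=
  M.quot.toAdjoinBoundary (M.proj x)

theorem continuous_toCompletion (M : NormalizedBLMMS.{u}) : Continuous M.toCompletion :=
  M.isRegular_quot_and_continuous_proj.1.adjoinBoundary.2.comp
    M.isRegular_quot_and_continuous_proj.2

/-- The measure `m` as a measure on its support. -/
noncomputable def suppMeas (M : NormalizedBLMMS.{u}) : Measure M.meas.support :=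
  M.meas.comap Subtype.val

theorem measurableSet_support (M : NormalizedBLMMS.{u}) : MeasurableSet M.meas.support :=
  Measure.isClosed_support.measurableSet

/-- The support has full measure because the space is second countable. -/
theorem map_val_suppMeas (M : NormalizedBLMMS.{u}) : M.suppMeas.map Subtype.val = M.meas := by
  have := M.isRegular_space.secondCountableTopology
  rw [suppMeas, map_comap_subtype_coe M.measurableSet_support]
  exact Measure.restrict_eq_self_of_ae_mem Measure.support_mem_ae

instance isProbabilityMeasure_suppMeas (M : NormalizedBLMMS.{u}) :
    IsProbabilityMeasure M.suppMeas := by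
  have := M.isProbabilityMeasure
  rw [← M.map_val_suppMeas] at this
  exact Measure.isProbabilityMeasure_of_map Subtype.val

theorem suppMeas_pos {x : M.meas.support} {U : Set M.meas.support} (hU : U ∈ 𝓝 x) :
    0 < M.suppMeas U := by
  obtain ⟨V, hV, hVU⟩ := mem_nhds_subtype _ _ _ |>.1 hU
  obtain ⟨O, hOV, hO, hxO⟩ := mem_nhds_iff.1 hV
  have hpos := (Measure.mem_support_iff_forall x.1).1 x.2 O (hO.mem_nhds hxO)
  rw [← M.map_val_suppMeas, Measure.map_apply measurable_subtype_coe hO.measurableSet] at hpos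
  exact hpos.trans_le (measure_mono ((preimage_mono hOV).trans hVU))

theorem mem_support_map_suppMeas {Q : Type*} [TopologicalSpace Q] [MeasurableSpace Q] [BorelSpace Q]
    {f : M.meas.support → Q} (hf : Continuous f) (x : M.meas.support) :
    f x ∈ (M.suppMeas.map f).support :=
  (Measure.mem_support_iff_forall _).2 fun _ hU =>
    (suppMeas_pos (hf.continuousAt hU)).trans_le (Measure.le_map_apply hf.measurable.aemeasurable _)

theorem quotMeas_map_toAdjoinBoundary (M : NormalizedBLMMS.{u}) :
    M.quotMeas.map M.quot.toAdjoinBoundary = M.suppMeas.map M.toCompletion :=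
  Measure.map_map M.isRegular_quot_and_continuous_proj.1.adjoinBoundary.2.measurable
    M.isRegular_quot_and_continuous_proj.2.measurable

instance isProbabilityMeasure_map_toCompletion (M : NormalizedBLMMS.{u}) :
    IsProbabilityMeasure (M.suppMeas.map M.toCompletion) :=
  Measure.isProbabilityMeasure_map M.continuous_toCompletion.measurable.aemeasurable

theorem toCompletion_cases (y : M.quot.adjoinBoundary) :
    y ∈ range M.toCompletion ∨ M.quot.adjoinBoundary.IsSpacelikeBoundary y := by
  refine (TimeSepSpace.adjoinBoundary_cases y).imp_left ?_
  rintro ⟨x, rfl⟩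
  obtain ⟨x, rfl⟩ := Quotient.exists_rep x
  exact ⟨x, rfl⟩

theorem mem_support_or_isSpacelikeBoundary (y : M.quot.adjoinBoundary) :
    y ∈ (M.suppMeas.map M.toCompletion).support ∨ M.quot.adjoinBoundary.IsSpacelikeBoundary y := by
  refine (toCompletion_cases y).imp_left ?_
  rintro ⟨x, rfl⟩
  exact mem_support_map_suppMeas M.continuous_toCompletion x

/-- Every point of the quotient is the image of a support point, and continuous images of support
points lie in the support of the pushforward. -/
theorem isoDomain_eq_univ (M : NormalizedBLMMS.{u}) : M.isoDomain = univ := by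
  refine eq_univ_of_forall fun y => (toCompletion_cases y).imp_left ?_
  rintro ⟨x, rfl⟩
  exact ⟨M.proj x, mem_support_map_suppMeas M.isRegular_quot_and_continuous_proj.2 x, rfl⟩

theorem map_val_isoMeas (M : NormalizedBLMMS.{u}) :
    M.isoMeas.map Subtype.val = M.suppMeas.map M.toCompletion := by
  rw [isoMeas, quotMeas_map_toAdjoinBoundary, map_comap_subtype_coe
    (by rw [isoDomain_eq_univ]; exact .univ), isoDomain_eq_univ, Measure.restrict_univ]

theorem map_pi_sepMatrix_adjoinBoundary (M : NormalizedBLMMS.{u}) (k : ℕ) :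
    (Measure.pi fun _ : Fin k => M.suppMeas.map M.toCompletion).map
        (M.quot.adjoinBoundary.sepMatrix k) =
      (Measure.pi fun _ : Fin k => M.meas).map (M.space.sepMatrix k) := by
  have := TimeSepSpace.map_pi_sepMatrix_eq (ρ := M.suppMeas) M.isRegular_adjoinBoundary_quot
    M.isRegular_space M.continuous_toCompletion.measurable measurable_subtype_coe
    (fun _ _ => rfl) k
  rwa [map_val_suppMeas] at this

theorem isomorphic_iff_map_sepMatrix_eq (M : NormalizedBLMMS.{u}) (M' : NormalizedBLMMS.{v}) :
    M.Isomorphic M' ↔ ∀ k, (Measure.pi fun _ : Fin k => M.meas).map (M.space.sepMatrix k) =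
      (Measure.pi fun _ : Fin k => M'.meas).map (M'.space.sepMatrix k) := by
  have hR := M.isRegular_adjoinBoundary_quot
  have hR' := M'.isRegular_adjoinBoundary_quot
  simp only [← map_pi_sepMatrix_adjoinBoundary]
  constructor
  · rintro ⟨ι, hι, hτ, hmap⟩ k
    have : IsProbabilityMeasure (M.isoMeas.map Subtype.val) := by
      rw [map_val_isoMeas]; infer_instance
    have : IsProbabilityMeasure M.isoMeas :=
      Measure.isProbabilityMeasure_of_map Subtype.val
    have := TimeSepSpace.map_pi_sepMatrix_eq (ρ := M.isoMeas) hR hR' measurable_subtype_coe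
      (measurable_subtype_coe.comp hι) hτ k
    rwa [← Measure.map_map measurable_subtype_coe hι, hmap, map_val_isoMeas, map_val_isoMeas]
      at this
  · intro h
    have := hR.compactSpace_adjoinBoundary
    have := hR'.compactSpace_adjoinBoundary
    obtain ⟨i, hi⟩ := M.quot.exists_isSpacelikeBoundary_adjoinBoundary
    obtain ⟨j, hj⟩ := M'.quot.exists_isSpacelikeBoundary_adjoinBoundary
    obtain ⟨ι, hι, hτ, hmap⟩ := TimeSepSpace.exists_continuous_map_eq hR hR' hi hj
      mem_support_or_isSpacelikeBoundary mem_support_or_isSpacelikeBoundary h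
    have hmem : ∀ y, y ∈ M'.isoDomain := fun y => M'.isoDomain_eq_univ ▸ mem_univ y
    have hmeas : Measurable fun x : M.isoDomain => (⟨ι x.1, hmem _⟩ : M'.isoDomain) :=
      (hι.measurable.comp measurable_subtype_coe).subtype_mk
    refine ⟨fun x => ⟨ι x.1, hmem _⟩, hmeas, fun x y => hτ _ _, ?_⟩
    refine (MeasurableEmbedding.subtype_coe (s := M'.isoDomain)
      (by rw [isoDomain_eq_univ]; exact .univ)).map_injective ?_
    rw [Measure.map_map measurable_subtype_coe hmeas, map_val_isoMeas, ← hmap, ← map_val_isoMeas,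
      Measure.map_map hι.measurable measurable_subtype_coe]
    rfl

theorem polynomial_eq_integral_map (M : NormalizedBLMMS.{u}) (k : ℕ)
    (φ : Matrix (Fin k) (Fin k) ℝ →ᵇ ℝ) :
    polynomial k φ M =
      ∫ A, φ A ∂(Measure.pi fun _ : Fin k => M.meas).map (M.space.sepMatrix k) :=
  (integral_map (M.isRegular_space.measurable_sepMatrix k).aemeasurable
    φ.continuous.measurable.aestronglyMeasurable).symm

theorem map_sepMatrix_eq_iff_polynomial_eq (M : NormalizedBLMMS.{u}) (M' : NormalizedBLMMS.{v})
    (k : ℕ) :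
    (Measure.pi fun _ : Fin k => M.meas).map (M.space.sepMatrix k) =
        (Measure.pi fun _ : Fin k => M'.meas).map (M'.space.sepMatrix k) ↔
      ∀ φ : Matrix (Fin k) (Fin k) ℝ →ᵇ ℝ, polynomial k φ M = polynomial k φ M' := by
  simp only [polynomial_eq_integral_map]
  refine ⟨fun h φ => by rw [h], fun h => ?_⟩
  have := M.isProbabilityMeasure
  have := M'.isProbabilityMeasure
  exact matrix_measure_ext h

end NormalizedBLMMS

theorem theorem1p1 (M : NormalizedBLMMS.{u}) (M' : NormalizedBLMMS.{v}) :
    (M.Isomorphic M' ↔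
      ∀ (k : ℕ) (φ : Matrix (Fin k) (Fin k) ℝ →ᵇ ℝ),
        NormalizedBLMMS.polynomial k φ M = NormalizedBLMMS.polynomial k φ M') ∧
    ∀ (Ω : Type w) [MeasurableSpace Ω] (P : Measure Ω) [IsProbabilityMeasure P]
      (X : ℕ → Ω → M.space) (X' : ℕ → Ω → M'.space),
      (∀ i, Measurable (X i)) → iIndepFun X P → (∀ i, P.map (X i) = M.meas) →
      (∀ i, Measurable (X' i)) → iIndepFun X' P → (∀ i, P.map (X' i) = M'.meas) →
      (M.Isomorphic M' ↔
        ∀ k : ℕ,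
          P.map (fun ω => M.space.sepMatrix k (fun i => X i ω)) =
            P.map (fun ω => M'.space.sepMatrix k (fun i => X' i ω))) := by
  rw [M.isomorphic_iff_map_sepMatrix_eq M']
  refine ⟨forall_congr' fun k => M.map_sepMatrix_eq_iff_polynomial_eq M' k, ?_⟩
  intro Ω _ P _ X X' hX hXi hXm hX' hXi' hXm'
  refine forall_congr' fun k => ?_
  rw [M.isRegular_space.map_sepMatrix_of_iIndepFun hX hXi hXm,
    M'.isRegular_space.map_sepMatrix_of_iIndepFun hX' hXi' hXm']
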